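/- Consider the matroid secretary problem: the elements of a matroid (loops are allowed) with nonnegative weights arrive one by one. When an element arrives, its weight is revealed and a randomized algorithm must irrevocably select or reject it, knowing only its own random bits, the weights of the elements that have arrived so far, in order of arrival, and which sets of arrived elements are independent (elements are identified by their order of arrival), together with the prior information specified below. The selected set must always be independent. For $\alpha\in\mathbb{R}$, an algorithm is an $\alpha$-approximation on a class of inputs if on every input of the class $\mathbb{E}[w(\mathrm{OPT})]\le\alpha\cdot\mathbb{E}[w(\mathrm{ALG})]$, where $\mathrm{ALG}$ is the selected set, $\mathrm{OPT}$ is a maximum-weight independent set, and the expectation is over the random bits of the algorithm and the randomness of the model. The models are: - AO-RA (adversarial order, random assignment): the adversary chooses the matroid, the order of arrival and a set of $n$ distinct nonnegative weights, where $n$ is the number of elements; the weights are assigned to the elements by a uniformly random bijection. In AO-RA-MN the algorithm knows $n$ in advance (and nothing else); in AO-RA-MU it knows nothing in advance. - RO-AA-MU (random order, adversarial assignment): the adversary chooses the matroid and the nonnegative weight of every element; the elements arrive in uniformly random order, and the algorithm knows nothing in advance, not even the number of elements. Then there are a constant $c>0$ and an integer $N_0$ such that for every $N\ge N_0$ and every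 $\alpha\in\mathbb{R}$: 1. if some algorithm is an $\alpha$-approximation in the AO-RA-MN model on all inputs with exactly $N$ elements, then $\alpha\ge c\,\frac{\log N}{\log\log N}$; 2. if some algorithm is an $\alpha$-approximation in the AO-RA-MU model on all inputs with exactly $N$ elements, then $\alpha\ge c\,\frac{\log N}{\log\log N}$; 3. if some algorithm is an $\alpha$-approximation in the RO-AA-MU model on all inputs with $n$ elements, for all $1\le n\le N$, then $\alpha\ge c\,\frac{\log N}{\log\log N}$. -/

import Mathlib

namespace MatroidSecretary

universe u

/-- A randomized online algorithm that knows nothing in advance about the input.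
When the element number `t` (counted from `0`) arrives, the algorithm decides irrevocably whether
to select it. The decision may use a random seed, the weights of the elements that have arrived so
far (listed in order of arrival, the current one included), and the answers of the independence
oracle on all sets of arrived elements. Elements are identified by their arrival positions. Earlier
decisions are determined by the seed and the earlier observations, so they need not be passed on. -/
structure OnlineAlgorithm where
  Seed : Type u
  [measurableSpace : MeasurableSpace Seed]
  prob : MeasureTheory.Measure Seed
  [isProb : MeasureTheory.IsProbabilityMeasure prob]
  accept : Seed → (t : ℕ) → (Fin (t + 1) → ℝ) → Set (Finset (Fin (t + 1))) → Bool
  measurable_accept : ∀ t x F, Measurable fun s => accept s t x F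

attribute [instance] OnlineAlgorithm.measurableSpace OnlineAlgorithm.isProb

/-- Prior information MU: nothing is known in advance, not even the number of elements. -/
abbrev MUAlgorithm := OnlineAlgorithm.{u}

/-- Prior information MN: the number `n` of elements is known in advance (and nothing else), so the
algorithm that is run may depend on `n`. -/
abbrev MNAlgorithm := ℕ → OnlineAlgorithm.{u}

section Run

variable {n : ℕ}

/-- The element that arrives at position `j`, for `j ≤ i`; the input order is `π`, that is, `π i`
is the element arriving at position `i`. -/
def arrived (π : Equiv.Perm (Fin n)) (i : Fin n) (j : Fin (i.val + 1)) : Fin n :=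
  π (Fin.castLE (Nat.succ_le_of_lt i.isLt) j)

/-- The weights of the elements at positions `0, …, i`. -/
def observedWeights (π : Equiv.Perm (Fin n)) (w : Fin n → ℝ) (i : Fin n) : Fin (i.val + 1) → ℝ :=
  fun j => w (arrived π i j)

/-- The sets of positions among `0, …, i` whose elements form an independent set. -/
def observedIndep (M : Matroid (Fin n)) (π : Equiv.Perm (Fin n)) (i : Fin n) :
    Set (Finset (Fin (i.val + 1))) :=
  {S | M.Indep (arrived π i '' (S : Set (Fin (i.val + 1))))}

/-- The set of elements selected by the algorithm `A` with random seed `s`, when the elements of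
the matroid `M`, with weights `w`, arrive in the order `π`. -/
def OnlineAlgorithm.selected (A : OnlineAlgorithm.{u}) (M : Matroid (Fin n))
    (π : Equiv.Perm (Fin n)) (w : Fin n → ℝ) (s : A.Seed) : Finset (Fin n) :=
  (Finset.univ.filter fun i : Fin n =>
    A.accept s i.val (observedWeights π w i) (observedIndep M π i) = true).map π.toEmbedding

/-- The expected weight (over the random seed) of the selected set. -/
noncomputable def OnlineAlgorithm.expectedWeight (A : OnlineAlgorithm.{u}) (M : Matroid (Fin n))
    (π : Equiv.Perm (Fin n)) (w : Fin n → ℝ) : ℝ :=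
  ∫ s, ∑ e ∈ A.selected M π w s, w e ∂A.prob

/-- The maximum weight of an independent set (a maximum over a finite nonempty family). -/
noncomputable def optWeight (M : Matroid (Fin n)) (w : Fin n → ℝ) : ℝ :=
  ⨆ S : {S : Finset (Fin n) // M.Indep (S : Set (Fin n))}, ∑ e ∈ S.1, w e

/-- The expectation of `f σ` for a uniformly random permutation `σ`. -/
noncomputable def permExpect (f : Equiv.Perm (Fin n) → ℝ) : ℝ :=
  (∑ σ : Equiv.Perm (Fin n), f σ) / (n.factorial : ℝ)

end Run

/-- AO-RA (adversarial order, random assignment) on inputs with exactly `n` elements: for every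
matroid, every input order `π` and every set of `n` nonnegative weights `w 0, …, w (n - 1)`, which
is assigned to the elements by a uniformly random permutation, the selected set is always
independent and `A` is an `α`-approximation in expectation. -/
def ApproximatesAORA (A : OnlineAlgorithm.{u}) (n : ℕ) (α : ℝ) : Prop :=
  ∀ (M : Matroid (Fin n)) (π : Equiv.Perm (Fin n)) (w : Fin n → ℝ),
    M.E = Set.univ → Function.Injective w → (∀ k, 0 ≤ w k) →
      (∀ (σ : Equiv.Perm (Fin n)) (s : A.Seed),
        M.Indep (A.selected M π (w ∘ σ) s : Set (Fin n))) ∧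
      permExpect (fun σ => optWeight M (w ∘ σ)) ≤
        α * permExpect (fun σ => A.expectedWeight M π (w ∘ σ))

/-- RO-AA (random order, adversarial assignment) on inputs with exactly `n` elements: for every
matroid and every nonnegative weight function `w` on its elements, which arrive in a uniformly
random order, the selected set is always independent and `A` is an `α`-approximation in
expectation. -/
def ApproximatesROAA (A : OnlineAlgorithm.{u}) (n : ℕ) (α : ℝ) : Prop :=
  ∀ (M : Matroid (Fin n)) (w : Fin n → ℝ),
    M.E = Set.univ → (∀ e, 0 ≤ w e) →
      (∀ (π : Equiv.Perm (Fin n)) (s : A.Seed),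
        M.Indep (A.selected M π w s : Set (Fin n))) ∧
      optWeight M w ≤ α * permExpect (fun π => A.expectedWeight M π w)

/-- `A` is an `α`-approximation in the AO-RA-MN model on inputs with `n` elements. -/
def ApproximatesAORAMN (A : MNAlgorithm.{u}) (n : ℕ) (α : ℝ) : Prop :=
  ApproximatesAORA (A n) n α

/-- `A` is an `α`-approximation in the AO-RA-MU model on inputs with `n` elements. -/
def ApproximatesAORAMU (A : MUAlgorithm.{u}) (n : ℕ) (α : ℝ) : Prop :=
  ApproximatesAORA A n α

/-- `A` is an `α`-approximation in the RO-AA-MU model on inputs with `n` elements. -/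
def ApproximatesROAAMU (A : MUAlgorithm.{u}) (n : ℕ) (α : ℝ) : Prop :=
  ApproximatesROAA A n α

end MatroidSecretary

/-! The hard matroids are almost trivial: `n` parallel elements, followed in the AO-RA models by
loops up to `N` elements. Until the first loop arrives, all of them look alike, so the acceptance
probabilities on a prefix do not depend on `n`, and their total is at most one because only one
parallel element can be kept. The algorithm must therefore do well for every `n = M ^ (2 * i)`, `i ≤
K`, with a single unit of acceptance mass.

The weights are spread over scales: about `N / M ^ (2 * j)` of them are at least `M ^ j`. Among the
first `M ^ (2 * i)` positions the maximum is then at least `M ^ i` with constant probability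
(`sum_perm_max_hardWeight_ge`), while still heavier weights contribute only `O(M ^ (i - 1))` or come
from mass placed after position `M ^ (2 * (i - 1))` (`sum_perm_selected_le`). A ratio `α` thus
forces mass of order `1 / α - O(1 / M)` into each of `K` disjoint windows. Summing gives `K = O(α)`
once `K ≤ M` (`le_of_competitive_hardWeight`), and `M ≈ log N` allows `K` of order `log N / log log
N`.

In RO-AA the loops are replaced by ignorance of `n`: the `n` weights are a prefix of a random
permutation of the hard set, and shuffling such a prefix again changes nothing
(`sum_perm_sum_perm_prefix`). -/

open Finset

namespace MatroidSecretary

universe u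

/-! ### First and second moments of uniformly random permutations -/

section PermAverages

variable {N : ℕ}

lemma sum_perm_apply_eq (f : Fin N → ℝ) (t t' : Fin N) :
    ∑ σ : Equiv.Perm (Fin N), f (σ t) = ∑ σ : Equiv.Perm (Fin N), f (σ t') := by
  rw [← Equiv.sum_comp (Equiv.mulRight (Equiv.swap t t'))]
  simp

/-- A uniformly random permutation maps every point to a uniformly random point. -/
lemma sum_perm_apply (f : Fin N → ℝ) (t : Fin N) :
    N * ∑ σ : Equiv.Perm (Fin N), f (σ t) = N.factorial * ∑ k, f k := by
  have h1 : ∑ t' : Fin N, ∑ σ : Equiv.Perm (Fin N), f (σ t')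
      = N * ∑ σ : Equiv.Perm (Fin N), f (σ t) := by
    rw [sum_congr rfl fun t' _ => sum_perm_apply_eq f t' t]
    simp
  rw [← h1, sum_comm, sum_congr rfl fun (σ : Equiv.Perm (Fin N)) _ => Equiv.sum_comp σ f]
  simp [Fintype.card_perm]

/-- The symmetric group is 2-transitive, and composing with a fixed permutation reindexes the sum.
-/
lemma sum_perm_apply_pair_eq (F : Fin N → Fin N → ℝ) {a b c d : Fin N} (hab : a ≠ b)
    (hcd : c ≠ d) :
    ∑ σ : Equiv.Perm (Fin N), F (σ a) (σ b) = ∑ σ : Equiv.Perm (Fin N), F (σ c) (σ d) := by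
  obtain ⟨τ, hτa, hτb⟩ := MulAction.is_two_pretransitive_iff.1
    (Equiv.Perm.isMultiplyPretransitive (Fin N) 2) hcd hab
  rw [← Equiv.sum_comp (Equiv.mulRight τ) fun σ : Equiv.Perm (Fin N) => F (σ c) (σ d)]
  rw [Equiv.Perm.smul_def] at hτa hτb
  simp [hτa, hτb]

/-- A uniformly random permutation maps every pair of distinct points to a uniformly random pair of
distinct points. -/
lemma sum_perm_apply_pair (F : Fin N → Fin N → ℝ) {a b : Fin N} (hab : a ≠ b) :
    N * (N - 1 : ℝ) * ∑ σ : Equiv.Perm (Fin N), F (σ a) (σ b)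
      = N.factorial * ∑ p ∈ (univ : Finset (Fin N)).offDiag, F p.1 p.2 := by
  have hN : 1 ≤ N := a.pos
  have h1 : ∑ p ∈ (univ : Finset (Fin N)).offDiag, ∑ σ : Equiv.Perm (Fin N), F (σ p.1) (σ p.2)
      = N * (N - 1 : ℝ) * ∑ σ : Equiv.Perm (Fin N), F (σ a) (σ b) := by
    rw [sum_congr rfl fun p hp => sum_perm_apply_pair_eq F (mem_offDiag.1 hp).2.2 hab]
    rw [sum_const, offDiag_card, nsmul_eq_mul, card_univ, Fintype.card_fin,
      Nat.cast_sub (Nat.le_mul_self N)]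
    push_cast
    ring
  have h2 (σ : Equiv.Perm (Fin N)) :
      ∑ p ∈ (univ : Finset (Fin N)).offDiag, F (σ p.1) (σ p.2)
        = ∑ p ∈ (univ : Finset (Fin N)).offDiag, F p.1 p.2 := by
    refine sum_equiv (Equiv.prodCongr σ σ) (fun p => ?_) fun p _ => rfl
    simp [mem_offDiag]
  rw [← h1, sum_comm, sum_congr rfl fun (σ : Equiv.Perm (Fin N)) _ => h2 σ]
  simp [Fintype.card_perm]

/-- The events that a random permutation maps `a` into `C` and `b` into `C` are negatively
correlated. -/
lemma sum_perm_indicator_pair_le (C : Finset (Fin N)) {a b : Fin N} (hab : a ≠ b) :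
    (N : ℝ) ^ 2 * ∑ σ : Equiv.Perm (Fin N),
        (if σ a ∈ C then (1 : ℝ) else 0) * (if σ b ∈ C then 1 else 0)
      ≤ N.factorial * (#C : ℝ) ^ 2 := by
  have h := sum_perm_apply_pair
    (fun x y => (if x ∈ C then (1 : ℝ) else 0) * (if y ∈ C then 1 else 0)) hab
  set S := ∑ σ : Equiv.Perm (Fin N),
        (if σ a ∈ C then (1 : ℝ) else 0) * (if σ b ∈ C then 1 else 0) with hS
  have hcard : ∑ p ∈ (univ : Finset (Fin N)).offDiag,
      (if p.1 ∈ C then (1 : ℝ) else 0) * (if p.2 ∈ C then 1 else 0) = (#C : ℝ) * (#C - 1) := by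
    have : ∀ p : Fin N × Fin N, (if p.1 ∈ C then (1 : ℝ) else 0) * (if p.2 ∈ C then 1 else 0)
        = if p.1 ∈ C ∧ p.2 ∈ C then 1 else 0 := by
      intro p; split_ifs <;> simp_all
    simp_rw [this]
    rw [sum_boole]
    have h3 : {p ∈ (univ : Finset (Fin N)).offDiag | p.1 ∈ C ∧ p.2 ∈ C} = C.offDiag := by
      ext p; simp [mem_offDiag]; tauto
    rw [h3, offDiag_card, Nat.cast_sub (Nat.le_mul_self _)]
    push_cast
    ring
  rw [hcard] at h
  have hN : (2 : ℝ) ≤ N := by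
    have := Fin.val_ne_of_ne hab
    exact_mod_cast (by omega : 2 ≤ N)
  have hC : (#C : ℝ) ≤ N := by exact_mod_cast (card_le_univ C).trans_eq (Fintype.card_fin N)
  have hC0 : (0 : ℝ) ≤ #C := by positivity
  have hf : (0 : ℝ) ≤ N.factorial := by positivity
  have h4 : (N - 1 : ℝ) * (N ^ 2 * S) ≤ (N - 1) * (N.factorial * (#C : ℝ) ^ 2) := by
    have e : (N - 1 : ℝ) * (N ^ 2 * S) = N.factorial * (#C * (N * (#C - 1))) := by
      linear_combination (N : ℝ) * h
    have e' : (N - 1 : ℝ) * (N.factorial * (#C : ℝ) ^ 2)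
        = N.factorial * (#C * ((N - 1) * #C)) := by ring
    rw [e, e']
    -- Sampling without replacement: `(#C - 1) / (N - 1) ≤ #C / N` because `#C ≤ N`.
    have e'' : (N : ℝ) * (#C - 1) ≤ (N - 1) * #C := by linarith
    exact mul_le_mul_of_nonneg_left (mul_le_mul_of_nonneg_left e'' hC0) hf
  exact le_of_mul_le_mul_left h4 (by linarith)

/-- Bonferroni's inequality for the event that a random permutation maps some point of `T`
into `C`. -/
lemma bonferroni_perm (T C : Finset (Fin N)) {μ : ℝ} (hμ : N * μ = #T * #C) (hN : 0 < N) :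
    N.factorial * (μ - μ ^ 2 / 2)
      ≤ ∑ σ : Equiv.Perm (Fin N), if ∃ t ∈ T, σ t ∈ C then (1 : ℝ) else 0 := by
  have hN' : (0 : ℝ) < N := by exact_mod_cast hN
  let X (σ : Equiv.Perm (Fin N)) (t : Fin N) : ℝ := if σ t ∈ C then 1 else 0
  -- With `m` hits this reads `m - m * (m - 1) / 2 ≤ 1` for `m ≥ 1`; the halving is there because
  -- `offDiag` counts ordered pairs.
  have hpt (σ : Equiv.Perm (Fin N)) :
      ∑ t ∈ T, X σ t - (∑ p ∈ T.offDiag, X σ p.1 * X σ p.2) / 2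
        ≤ if ∃ t ∈ T, σ t ∈ C then (1 : ℝ) else 0 := by
    have h1 : ∑ t ∈ T, X σ t = #{t ∈ T | σ t ∈ C} := by simp [X]
    have h2 : (∑ t ∈ T, X σ t) * ∑ t ∈ T, X σ t
        = ∑ t ∈ T, X σ t + ∑ p ∈ T.offDiag, X σ p.1 * X σ p.2 := by
      rw [sum_mul_sum, ← sum_product', ← diag_union_offDiag,
        sum_union (disjoint_diag_offDiag T), sum_diag]
      congr 1
      exact sum_congr rfl fun t _ => by simp [X]
    rw [h1] at h2 ⊢
    split_ifs with h
    · generalize #{t ∈ T | σ t ∈ C} = m at h2 ⊢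
      rcases Nat.lt_or_ge m 2 with hm | hm
      · interval_cases m <;> norm_num at h2 ⊢ <;> linarith
      · have : (2 : ℝ) ≤ m := by exact_mod_cast hm
        nlinarith
    · have h0 : #{t ∈ T | σ t ∈ C} = 0 := by
        rw [card_eq_zero, filter_eq_empty_iff]
        exact fun t ht hC => h ⟨t, ht, hC⟩
      rw [h0] at h2 ⊢
      norm_num at h2 ⊢
      linarith
  refine le_trans ?_ (sum_le_sum fun σ _ => hpt σ)
  rw [sum_sub_distrib, ← sum_div, sum_comm, sum_comm (t := T.offDiag)]
  have hA : N * ∑ t ∈ T, ∑ σ, X σ t = N.factorial * (N * μ) := by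
    rw [mul_sum, sum_congr rfl fun t _ => sum_perm_apply (fun k => if k ∈ C then (1 : ℝ) else 0) t]
    rw [hμ]
    simp
    ring
  have hB : (N : ℝ) ^ 2 * ∑ p ∈ T.offDiag, ∑ σ, X σ p.1 * X σ p.2
      ≤ N.factorial * (N * μ) ^ 2 := by
    rw [mul_sum]
    refine (sum_le_sum fun p hp =>
      sum_perm_indicator_pair_le C (mem_offDiag.1 hp).2.2).trans ?_
    rw [sum_const, nsmul_eq_mul, hμ]
    have : (#T.offDiag : ℝ) ≤ (#T : ℝ) ^ 2 := by
      rw [offDiag_card, sq]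
      exact_mod_cast Nat.sub_le _ _
    calc (#T.offDiag : ℝ) * (N.factorial * (#C : ℝ) ^ 2)
        ≤ (#T : ℝ) ^ 2 * (N.factorial * (#C : ℝ) ^ 2) := by gcongr
      _ = _ := by ring
  have hA' : ∑ t ∈ T, ∑ σ, X σ t = N.factorial * μ := by
    apply mul_left_cancel₀ hN'.ne'
    rw [hA]; ring
  have hB' : ∑ p ∈ T.offDiag, ∑ σ, X σ p.1 * X σ p.2 ≤ N.factorial * μ ^ 2 := by
    refine le_of_mul_le_mul_left (hB.trans_eq ?_) (by positivity : (0 : ℝ) < (N : ℝ) ^ 2)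
    ring
  rw [hA']
  linarith

end PermAverages

/-! ### The multi-scale weight set -/

section HardWeights

/-- The order of magnitude, in powers of `M`, of the weight number `k` of the hard weight set. -/
def weightClass (M N k : ℕ) : ℕ := Nat.log (M ^ 2) (N / (k + 1))

/-- A set of `N` distinct weights of which about `N / M ^ (2 * j)` are at least `M ^ j`. -/
noncomputable def hardWeight (M N : ℕ) (k : Fin N) : ℝ := M ^ weightClass M N k + k / N

variable {M N : ℕ}

/-- Using the rank `k + 1` in `weightClass` makes the floor divisions match exactly, so counting a
class produces no rounding error. -/
lemma le_weightClass_iff (hM : 2 ≤ M) {j k : ℕ} (hk : k < N) :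
    j ≤ weightClass M N k ↔ k < N / (M ^ 2) ^ j := by
  have hM2 : 1 < M ^ 2 := by nlinarith
  have hpos : 0 < (M ^ 2) ^ j := by positivity
  have h0 : N / (k + 1) ≠ 0 := (Nat.div_pos hk k.succ_pos).ne'
  rw [weightClass, Nat.le_log_iff_pow_le hM2 h0, Nat.le_div_iff_mul_le k.succ_pos,
    Nat.lt_iff_add_one_le, Nat.le_div_iff_mul_le hpos, mul_comm]

lemma card_le_weightClass (hM : 2 ≤ M) (j : ℕ) :
    #{k : Fin N | j ≤ weightClass M N k} = N / (M ^ 2) ^ j := by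
  rw [filter_congr fun (k : Fin N) _ => le_weightClass_iff hM k.2, Fin.card_filter_val_lt, min_eq_right (Nat.div_le_self _ _)]

lemma hardWeight_nonneg (k : Fin N) : 0 ≤ hardWeight M N k := by
  unfold hardWeight; positivity

lemma pow_le_hardWeight (k : Fin N) : (M : ℝ) ^ weightClass M N k ≤ hardWeight M N k := by
  unfold hardWeight; simp; positivity

/-- The tie-breaking term `k / N` is at most one, hence at most the main term. -/
lemma hardWeight_le (hM : 1 ≤ M) (k : Fin N) :
    hardWeight M N k ≤ 2 * (M : ℝ) ^ weightClass M N k := by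
  have h1 : (k : ℝ) / N ≤ 1 := by
    apply div_le_one_of_le₀ _ (by positivity)
    exact_mod_cast k.2.le
  have h2 : (1 : ℝ) ≤ (M : ℝ) ^ weightClass M N k := one_le_pow₀ (by exact_mod_cast hM)
  unfold hardWeight
  linarith

/-- After scaling by `N`, the index is the residue modulo `N`. -/
lemma hardWeight_injective : Function.Injective (hardWeight M N) := by
  intro k l h
  have hN : 0 < N := k.pos
  have hN' : (N : ℝ) ≠ 0 := by positivity
  unfold hardWeight at h
  field_simp at h
  have h' : N * M ^ weightClass M N k + k = N * M ^ weightClass M N l + l := by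
    rw [mul_comm N]; exact_mod_cast h
  have := congrArg (· % N) h'
  simp only [Nat.mul_add_mod, Nat.mod_eq_of_lt k.2, Nat.mod_eq_of_lt l.2] at this
  exact Fin.ext this

/-- The contribution of the weights of class at least `a` to the sum of all weights. -/
lemma sum_pow_weightClass_le (hM : 2 ≤ M) (a : ℕ) :
    (M : ℝ) ^ a * ∑ k : Fin N, (if a ≤ weightClass M N k then (M : ℝ) ^ weightClass M N k else 0)
      ≤ 2 * N := by
  have hM' : (2 : ℝ) ≤ M := by exact_mod_cast hM
  have hM0 : (0 : ℝ) < M := by linarith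
  obtain ⟨J, hJ⟩ : ∃ J, ∀ k : Fin N, weightClass M N k < J :=
    ⟨Nat.log (M ^ 2) N + 1, fun k =>
      Nat.lt_succ_of_le (Nat.log_mono_right (Nat.div_le_self _ _))⟩
  -- Bounding the top power by the sum of all powers from `a` up lets the tail counts
  -- `card_le_weightClass` be used in place of the exact class sizes.
  have h1 (k : Fin N) : (if a ≤ weightClass M N k then (M : ℝ) ^ weightClass M N k else 0)
      ≤ ∑ j ∈ Ico a J, if j ≤ weightClass M N k then (M : ℝ) ^ j else 0 := by
    have hnn : ∀ j ∈ Ico a J, 0 ≤ if j ≤ weightClass M N k then (M : ℝ) ^ j else 0 := by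
      intro j _; split_ifs <;> positivity
    split_ifs with h
    · have := single_le_sum hnn (mem_Ico.2 ⟨h, hJ k⟩)
      simpa using this
    · exact sum_nonneg hnn
  have h2 : ∑ k : Fin N, (if a ≤ weightClass M N k then (M : ℝ) ^ weightClass M N k else 0)
      ≤ ∑ j ∈ Ico a J, N * (1 / (M : ℝ)) ^ j := by
    refine (sum_le_sum fun k _ => h1 k).trans ?_
    rw [sum_comm]
    refine sum_le_sum fun j _ => ?_
    rw [← sum_filter, sum_const, nsmul_eq_mul, card_le_weightClass hM]
    calc ((N / (M ^ 2) ^ j : ℕ) : ℝ) * (M : ℝ) ^ j ≤ (N / ((M ^ 2) ^ j : ℕ) : ℝ) * (M : ℝ) ^ j := by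
          gcongr; exact Nat.cast_div_le
      _ = N * (1 / (M : ℝ)) ^ j := by
          push_cast
          rw [one_div, inv_pow, pow_right_comm]
          field_simp
  have hgeom : ∀ J, ∑ j ∈ Ico a J, (1 / (M : ℝ)) ^ j ≤ 2 * (1 / (M : ℝ)) ^ a := by
    intro J
    have hr : 1 / (M : ℝ) ≤ 1 / 2 := by gcongr
    have hr0 : 0 ≤ 1 / (M : ℝ) := by positivity
    refine (geom_sum_Ico_le_of_lt_one hr0 (by linarith)).trans ?_
    rw [div_le_iff₀ (by linarith)]
    have : 0 ≤ (1 / (M : ℝ)) ^ a := by positivity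
    nlinarith
  calc _ ≤ (M : ℝ) ^ a * ∑ j ∈ Ico a J, N * (1 / (M : ℝ)) ^ j := by gcongr
    _ ≤ (M : ℝ) ^ a * (N * (2 * (1 / (M : ℝ)) ^ a)) := by
        rw [← mul_sum]; gcongr; exact hgeom J
    _ = 2 * N := by rw [one_div, inv_pow]; field_simp

end HardWeights

/-! ### Lower bound for selection rules of total mass at most one -/

section HardDistribution

variable {M N : ℕ}

/-- With constant probability, one of the first `M ^ (2 * i)` weights is at least `M ^ i`. -/
lemma sum_perm_max_hardWeight_ge (hM : 2 ≤ M) {i : ℕ} (hi : (M ^ 2) ^ i ≤ N)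
    (opt : Equiv.Perm (Fin N) → ℝ)
    (hopt : ∀ σ t, t.val < (M ^ 2) ^ i → hardWeight M N (σ t) ≤ opt σ) :
    N.factorial * (M : ℝ) ^ i ≤ 4 * ∑ σ, opt σ := by
  have hL : 0 < (M ^ 2) ^ i := by positivity
  have hN : 0 < N := hL.trans_le hi
  have hN' : (0 : ℝ) < N := by exact_mod_cast hN
  set L := (M ^ 2) ^ i with hLdef
  let T : Finset (Fin N) := {t | t.val < L}
  let C : Finset (Fin N) := {k | i ≤ weightClass M N k}
  have hT : #T = L := by rw [Fin.card_filter_val_lt, min_eq_right hi]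
  have hC : #C = N / L := card_le_weightClass hM i
  obtain ⟨μ, hμ⟩ : ∃ μ : ℝ, N * μ = #T * #C := ⟨#T * #C / N, by field_simp⟩
  have hB := bonferroni_perm T C hμ hN
  rw [hT, hC] at hμ
  have hμ1 : μ ≤ 1 := by
    have : (L : ℝ) * (N / L : ℕ) ≤ N := by exact_mod_cast Nat.mul_div_le N L
    exact le_of_mul_le_mul_left (by linarith) hN'
  -- `μ` is the expected number of hits, `L * ⌊N / L⌋ / N`; rounding loses at most a factor two
  -- since `L ≤ N`.
  have hμ2 : 1 / 2 ≤ μ := by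
    have h1 : N < L * (N / L) + L := by
      have := Nat.lt_mul_div_succ N hL
      linarith
    have h2 : L ≤ L * (N / L) := Nat.le_mul_of_pos_right _ (Nat.div_pos hi hL)
    have : (N : ℝ) ≤ 2 * (L * (N / L : ℕ)) := by exact_mod_cast (by omega)
    refine le_of_mul_le_mul_left ?_ hN'
    linarith
  have hpt (σ : Equiv.Perm (Fin N)) :
      (M : ℝ) ^ i * (if ∃ t ∈ T, σ t ∈ C then (1 : ℝ) else 0) ≤ opt σ := by
    split_ifs with h
    · obtain ⟨t, ht, hc⟩ := h
      have hc' : i ≤ weightClass M N (σ t) := by simpa [C] using hc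
      have ht' : t.val < L := by simpa [T] using ht
      calc (M : ℝ) ^ i * 1 ≤ (M : ℝ) ^ weightClass M N (σ t) := by
            rw [mul_one]
            exact pow_le_pow_right₀ (by exact_mod_cast (by omega : 1 ≤ M)) hc'
        _ ≤ _ := (pow_le_hardWeight _).trans (hopt σ t ht')
    · rw [mul_zero]
      -- `opt` is nonnegative because it dominates the weight at position `0`.
      exact (hardWeight_nonneg _).trans (hopt σ ⟨0, hN⟩ hL)
  have hs := sum_le_sum fun σ (_ : σ ∈ univ) => hpt σ
  rw [← mul_sum] at hs
  have h3 : (1 : ℝ) / 4 ≤ μ - μ ^ 2 / 2 := by nlinarith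
  have h4 : N.factorial * (1 / 4 : ℝ)
      ≤ ∑ σ : Equiv.Perm (Fin N), if ∃ t ∈ T, σ t ∈ C then (1 : ℝ) else 0 :=
    (mul_le_mul_of_nonneg_left h3 (by positivity)).trans hB
  have h5 := mul_le_mul_of_nonneg_left h4 (by positivity : (0 : ℝ) ≤ (M : ℝ) ^ i)
  linarith

/-- The expected total weight of the elements of weight class at least `a` among the first `n`. -/
lemma sum_perm_heavy_le (hM : 2 ≤ M) (n a : ℕ) :
    (M : ℝ) ^ a * ∑ σ : Equiv.Perm (Fin N), ∑ t : Fin N, (if t.val < n then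
        (if a ≤ weightClass M N (σ t) then (M : ℝ) ^ weightClass M N (σ t) else 0) else 0)
      ≤ 2 * n * N.factorial := by
  rcases N.eq_zero_or_pos with rfl | hN
  · simp
  have hN' : (0 : ℝ) < N := by exact_mod_cast hN
  let f (k : Fin N) : ℝ := if a ≤ weightClass M N k then (M : ℝ) ^ weightClass M N k else 0
  have hf : (M : ℝ) ^ a * ∑ k, f k ≤ 2 * N := sum_pow_weightClass_le hM a
  rw [sum_comm]
  have h1 (t : Fin N) : (M : ℝ) ^ a * ∑ σ : Equiv.Perm (Fin N), f (σ t) ≤ 2 * N.factorial := by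
    refine le_of_mul_le_mul_left ?_ hN'
    calc (N : ℝ) * (M ^ a * ∑ σ : Equiv.Perm (Fin N), f (σ t))
        = M ^ a * (N * ∑ σ : Equiv.Perm (Fin N), f (σ t)) := by ring
      _ = N.factorial * (M ^ a * ∑ k, f k) := by rw [sum_perm_apply]; ring
      _ ≤ N.factorial * (2 * N) := by gcongr
      _ = _ := by ring
  calc _ = ∑ t : Fin N, if t.val < n then
          (M : ℝ) ^ a * ∑ σ : Equiv.Perm (Fin N), f (σ t) else 0 := by
        rw [mul_sum]
        refine sum_congr rfl fun t _ => ?_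
        split_ifs <;> simp [f]
    _ ≤ ∑ t : Fin N, if t.val < n then 2 * (N.factorial : ℝ) else 0 := by
        refine sum_le_sum fun t _ => ?_
        split_ifs
        · exact h1 t
        · exact le_rfl
    _ = (min N n : ℕ) * (2 * (N.factorial : ℝ)) := by
        rw [← sum_filter, sum_const, Fin.card_filter_val_lt, nsmul_eq_mul]
    _ ≤ n * (2 * (N.factorial : ℝ)) := by gcongr; exact min_le_right _ _
    _ = _ := by ring

/-- An upper bound on the expected weight among the first `M ^ (2 * (i + 1))` elements that is
collected by a selection rule `g` of total mass at most one. -/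
lemma sum_perm_selected_le (hM : 2 ≤ M) {K i : ℕ} (hi : i < K)
    (g : Equiv.Perm (Fin N) → Fin N → ℝ) (hg0 : ∀ σ t, 0 ≤ g σ t)
    (hg1 : ∀ σ, ∑ t with t.val < (M ^ 2) ^ K, g σ t ≤ 1) :
    ∑ σ, ∑ t with t.val < (M ^ 2) ^ (i + 1), g σ t * hardWeight M N (σ t)
      ≤ 2 * (M : ℝ) ^ (i + 1) * (∑ σ, (∑ t with t.val < (M ^ 2) ^ (i + 1), g σ t
          - ∑ t with t.val < (M ^ 2) ^ i, g σ t))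
        + 10 * (M : ℝ) ^ i * N.factorial := by
  have hM' : (2 : ℝ) ≤ M := by exact_mod_cast hM
  have hM0 : (0 : ℝ) < M := by linarith
  have hL1 : 1 ≤ M ^ 2 := Nat.one_le_pow _ _ (by omega)
  have hmono : (M ^ 2) ^ i ≤ (M ^ 2) ^ (i + 1) := Nat.pow_le_pow_right hL1 i.le_succ
  have hmonoK : (M ^ 2) ^ (i + 1) ≤ (M ^ 2) ^ K := Nat.pow_le_pow_right hL1 hi
  set A := (M ^ 2) ^ i with hA
  set B := (M ^ 2) ^ (i + 1) with hB
  set D := (M ^ 2) ^ K with hD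
  let f (a : ℕ) (k : Fin N) : ℝ :=
    if a ≤ weightClass M N k then (M : ℝ) ^ weightClass M N k else 0
  have hf0 (a : ℕ) (k : Fin N) : 0 ≤ f a k := by
    simp only [f]; split_ifs <;> positivity
  -- The four terms cover: class at most `i`, paid by the total mass; class `i + 1` inside the
  -- window from `A` to `B`, paid by the mass there; class at least `i + 1` before `A`, and class at
  -- least `i + 2` before `B`, both so rare that `g ≤ 1` suffices.
  have hpt (σ : Equiv.Perm (Fin N)) (t : Fin N) :
      (if t.val < B then g σ t * hardWeight M N (σ t) else 0)
        ≤ 2 * (M : ℝ) ^ i * (if t.val < D then g σ t else 0)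
          + 2 * (M : ℝ) ^ (i + 1)
            * ((if t.val < B then g σ t else 0) - (if t.val < A then g σ t else 0))
          + 2 * (if t.val < A then f (i + 1) (σ t) else 0)
          + 2 * (if t.val < B then f (i + 2) (σ t) else 0) := by
    have hg := hg0 σ t
    have hp : (0 : ℝ) ≤ (M : ℝ) ^ i := by positivity
    have hp' : (0 : ℝ) ≤ (M : ℝ) ^ (i + 1) := by positivity
    by_cases htB : t.val < B
    · have htD : t.val < D := htB.trans_le hmonoK
      have hgle : g σ t ≤ 1 := (single_le_sum (f := g σ) (fun t _ => hg0 σ t)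
        (mem_filter.2 ⟨mem_univ t, htD⟩)).trans (hg1 σ)
      have hw := hardWeight_le (M := M) (by omega) (σ t)
      have hw1 : g σ t * hardWeight M N (σ t)
          ≤ g σ t * (2 * (M : ℝ) ^ weightClass M N (σ t)) := by gcongr
      have hw2 : g σ t * (2 * (M : ℝ) ^ weightClass M N (σ t))
          ≤ 1 * (2 * (M : ℝ) ^ weightClass M N (σ t)) := by gcongr
      have hc {b : ℕ} (hb : weightClass M N (σ t) ≤ b) :
          g σ t * (2 * (M : ℝ) ^ weightClass M N (σ t)) ≤ g σ t * (2 * (M : ℝ) ^ b) := by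
        gcongr
        linarith
      have hf1 := hf0 (i + 1) (σ t)
      have hf2 := hf0 (i + 2) (σ t)
      have hgp := mul_nonneg hp hg
      have hgp' := mul_nonneg hp' hg
      rcases Nat.lt_or_ge (weightClass M N (σ t)) (i + 1) with h1 | h1
      · have := hc (Nat.lt_succ_iff.1 h1)
        simp only [htB, htD, if_true]
        split_ifs <;> linarith
      · rcases Nat.lt_or_ge (weightClass M N (σ t)) (i + 2) with h2 | h2
        · have := hc (Nat.lt_succ_iff.1 h2)
          have e1 : f (i + 1) (σ t) = (M : ℝ) ^ weightClass M N (σ t) := by simp [f, h1]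
          simp only [htB, htD, if_true]
          split_ifs <;> linarith
        · have e2 : f (i + 2) (σ t) = (M : ℝ) ^ weightClass M N (σ t) := by simp [f, h2]
          simp only [htB, htD, if_true]
          split_ifs <;> linarith
    · have htA : ¬ t.val < A := fun h => htB (h.trans_le hmono)
      simp only [htA, htB, if_false]
      split_ifs <;> (simp; try positivity)
  have hsum : ∑ σ, ∑ t with t.val < B, g σ t * hardWeight M N (σ t)
      ≤ 2 * (M : ℝ) ^ i * (∑ σ, ∑ t with t.val < D, g σ t)
        + 2 * (M : ℝ) ^ (i + 1) * (∑ σ, (∑ t with t.val < B, g σ t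
          - ∑ t with t.val < A, g σ t))
        + 2 * (∑ σ : Equiv.Perm (Fin N), ∑ t : Fin N, if t.val < A then f (i + 1) (σ t) else 0)
        + 2 * (∑ σ : Equiv.Perm (Fin N), ∑ t : Fin N,
            if t.val < B then f (i + 2) (σ t) else 0) := by
    simp only [sum_filter]
    refine (sum_le_sum fun σ _ => sum_le_sum fun t _ => hpt σ t).trans_eq ?_
    simp only [sum_add_distrib, sum_sub_distrib, ← mul_sum]
  have hone : ∑ σ, ∑ t with t.val < D, g σ t ≤ N.factorial := by
    refine (sum_le_sum fun σ _ => hg1 σ).trans_eq ?_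
    simp [Fintype.card_perm]
  have hA' := sum_perm_heavy_le (N := N) hM A (i + 1)
  have hB' := sum_perm_heavy_le (N := N) hM B (i + 2)
  set SA := ∑ σ : Equiv.Perm (Fin N), ∑ t : Fin N,
    if t.val < A then f (i + 1) (σ t) else 0
  set SB := ∑ σ : Equiv.Perm (Fin N), ∑ t : Fin N,
    if t.val < B then f (i + 2) (σ t) else 0
  have hF : (0 : ℝ) ≤ N.factorial := by positivity
  have hp : (0 : ℝ) < (M : ℝ) ^ i := by positivity
  have hSA : SA ≤ (M : ℝ) ^ i * N.factorial := by
    have h1 : (M : ℝ) ^ (i + 1) * SA ≤ 2 * A * N.factorial := hA'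
    have h2 : (A : ℝ) = (M : ℝ) ^ i * (M : ℝ) ^ i := by rw [hA]; push_cast; ring
    rw [h2] at h1
    refine le_of_mul_le_mul_left (a := (M : ℝ) ^ (i + 1)) (h1.trans ?_) (by positivity)
    calc 2 * ((M : ℝ) ^ i * (M : ℝ) ^ i) * N.factorial
        ≤ M * ((M : ℝ) ^ i * (M : ℝ) ^ i) * N.factorial := by gcongr
      _ = _ := by ring
  have hSB : SB ≤ 2 * (M : ℝ) ^ i * N.factorial := by
    have h1 : (M : ℝ) ^ (i + 2) * SB ≤ 2 * B * N.factorial := hB'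
    have h2 : (B : ℝ) = (M : ℝ) ^ (i + 2) * (M : ℝ) ^ i := by rw [hB]; push_cast; ring
    rw [h2] at h1
    refine le_of_mul_le_mul_left (a := (M : ℝ) ^ (i + 2)) (h1.trans_eq ?_) (by positivity)
    ring
  have h1 := mul_le_mul_of_nonneg_left hone (by positivity : 0 ≤ 2 * (M : ℝ) ^ i)
  have hF' : 0 ≤ (M : ℝ) ^ i * N.factorial := by positivity
  linarith

/-- The hard weight distribution: a selection rule `g` of total mass at most one cannot be
competitive for all the numbers `M ^ (2 * i)`, `i ≤ K`, of elements. -/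
theorem le_of_competitive_hardWeight (hM : 2 ≤ M) {K : ℕ} (hK : (M ^ 2) ^ K ≤ N) (hKM : K ≤ M)
    (g : Equiv.Perm (Fin N) → Fin N → ℝ) (hg0 : ∀ σ t, 0 ≤ g σ t)
    (hg1 : ∀ σ, ∑ t with t.val < (M ^ 2) ^ K, g σ t ≤ 1) (α : ℝ)
    (h : ∀ i ≤ K, ∃ opt : Equiv.Perm (Fin N) → ℝ,
      (∀ σ t, t.val < (M ^ 2) ^ i → hardWeight M N (σ t) ≤ opt σ) ∧
      ∑ σ, opt σ ≤ α * ∑ σ, ∑ t with t.val < (M ^ 2) ^ i, g σ t * hardWeight M N (σ t)) :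
    K ≤ 48 * α := by
  have hM' : (2 : ℝ) ≤ M := by exact_mod_cast hM
  have hM0 : (0 : ℝ) < M := by linarith
  have hF : (0 : ℝ) < N.factorial := by positivity
  have hL1 : 1 ≤ M ^ 2 := Nat.one_le_pow _ _ (by omega)
  -- A negative `α` would make the expected optimum for a single element nonpositive.
  have hα : 0 ≤ α := by
    obtain ⟨opt, ho, ha⟩ := h 0 K.zero_le
    have h1 := sum_perm_max_hardWeight_ge hM ((Nat.pow_le_pow_right hL1 K.zero_le).trans hK) opt ho
    have h2 : 0 ≤ ∑ σ, ∑ t with t.val < (M ^ 2) ^ 0, g σ t * hardWeight M N (σ t) :=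
      sum_nonneg fun σ _ => sum_nonneg fun t _ => mul_nonneg (hg0 σ t) (hardWeight_nonneg _)
    by_contra hneg
    have h3 := mul_nonpos_of_nonpos_of_nonneg (not_le.1 hneg).le h2
    simp only [pow_zero, mul_one] at h1
    simp only [pow_zero] at ha h3
    linarith
  let G (i : ℕ) : ℝ := ∑ σ, ∑ t with t.val < (M ^ 2) ^ i, g σ t
  -- `G (i + 1) - G i` is the mass in the window, so the sum over `i` telescopes.
  have hstep : ∀ i ∈ range K,
      N.factorial * (M : ℝ) ≤ 4 * α * (2 * M * (G (i + 1) - G i) + 10 * N.factorial) := by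
    intro i hi
    have hiK : i < K := mem_range.1 hi
    obtain ⟨opt, ho, ha⟩ := h (i + 1) hiK
    have h1 := sum_perm_max_hardWeight_ge hM ((Nat.pow_le_pow_right hL1 hiK).trans hK) opt ho
    have h2 := mul_le_mul_of_nonneg_left (sum_perm_selected_le hM hiK g hg0 hg1) hα
    rw [sum_sub_distrib] at h2
    change _ ≤ α * (2 * (M : ℝ) ^ (i + 1) * (G (i + 1) - G i) + _) at h2
    refine le_of_mul_le_mul_left (a := (M : ℝ) ^ i) ?_ (by positivity)
    rw [Nat.succ_eq_add_one] at h1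
    calc (M : ℝ) ^ i * (N.factorial * M) = N.factorial * (M : ℝ) ^ (i + 1) := by ring
      _ ≤ 4 * (α * (2 * (M : ℝ) ^ (i + 1) * (G (i + 1) - G i)
            + 10 * (M : ℝ) ^ i * N.factorial)) := by
          refine h1.trans ?_
          gcongr
          exact ha.trans h2
      _ = _ := by ring
  have hsum := sum_le_sum hstep
  rw [sum_const, ← mul_sum (range K) _ (4 * α), sum_add_distrib, ← mul_sum, sum_range_sub G,
    sum_const, card_range, nsmul_eq_mul, nsmul_eq_mul] at hsum
  have hGK : G K ≤ N.factorial := by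
    refine (sum_le_sum fun σ _ => hg1 σ).trans_eq ?_
    simp [Fintype.card_perm]
  have hG0 : 0 ≤ G 0 := sum_nonneg fun σ _ => sum_nonneg fun t _ => hg0 σ t
  have hKM' : (K : ℝ) ≤ M := by exact_mod_cast hKM
  -- Here `K ≤ M` absorbs the accumulated error terms; `4 * (2 + 10)` is the final constant 48.
  have hb : 2 * M * (G K - G 0) + K * (10 * (N.factorial : ℝ)) ≤ 12 * (M * N.factorial) := by
    have e1 : 2 * (M : ℝ) * (G K - G 0) ≤ 2 * M * N.factorial := by gcongr; linarith
    have e2 : (K : ℝ) * (10 * (N.factorial : ℝ)) ≤ M * (10 * (N.factorial : ℝ)) := by gcongr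
    linarith
  have hfin := hsum.trans (mul_le_mul_of_nonneg_left hb (by positivity : 0 ≤ 4 * α))
  refine le_of_mul_le_mul_left (a := (N.factorial : ℝ) * M) ?_ (by positivity)
  linarith

end HardDistribution

/-! ### Parallel elements followed by loops -/

section ParallelMatroid

/-- The matroid whose first `n` elements are parallel, and whose other elements are loops. -/
def parallelMatroid (N n : ℕ) : Matroid (Fin N) :=
  (IndepMatroid.ofFinite (E := Set.univ) Set.finite_univ
    (fun I => I.Subsingleton ∧ ∀ e ∈ I, e.val < n)
    ⟨Set.subsingleton_empty, fun _ h => h.elim⟩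
    (fun _ _ hJ hIJ => ⟨hJ.1.anti hIJ, fun e he => hJ.2 e (hIJ he)⟩)
    (fun I J _ hJ hlt => by
      have hJ1 : J.ncard ≤ 1 := Set.ncard_le_one_iff_subsingleton.2 hJ.1
      have hI : I = ∅ := (Set.ncard_eq_zero).1 (by omega)
      obtain ⟨e, he⟩ := Set.nonempty_of_ncard_ne_zero (by omega : J.ncard ≠ 0)
      subst hI
      refine ⟨e, he, Set.notMem_empty e, ?_, ?_⟩
      · simp
      · simpa using hJ.2 e he)
    fun _ _ => Set.subset_univ _).matroid

variable {N n : ℕ}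

lemma parallelMatroid_ground : (parallelMatroid N n).E = Set.univ := rfl

lemma parallelMatroid_indep {I : Set (Fin N)} :
    (parallelMatroid N n).Indep I ↔ I.Subsingleton ∧ ∀ e ∈ I, e.val < n := Iff.rfl

lemma arrived_injective (π : Equiv.Perm (Fin N)) (i : Fin N) :
    Function.Injective (arrived π i) :=
  π.injective.comp (Fin.castLE_injective _)

/-- As long as no loop has arrived, the independence oracle does not reveal `n`. -/
lemma observedIndep_parallelMatroid {π : Equiv.Perm (Fin N)} {i : Fin N}
    (h : ∀ j, (arrived π i j).val < n) :
    observedIndep (parallelMatroid N n) π i = {S | #S ≤ 1} := by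
  ext S
  simp only [observedIndep, Set.mem_ofPred_eq, parallelMatroid_indep,
    card_le_one_iff_subsingleton]
  refine ⟨fun hS => Set.subsingleton_of_image (arrived_injective π i) _ hS.1,
    fun hS => ⟨hS.image _, ?_⟩⟩
  rintro _ ⟨j, _, rfl⟩
  exact h j

lemma arrived_one_lt {i : Fin N} (hi : i.val < n) (j : Fin (i.val + 1)) :
    (arrived 1 i j).val < n := by
  have := j.2
  simp only [arrived, Equiv.Perm.one_apply, Fin.val_castLE]
  omega

lemma le_optWeight (M : Matroid (Fin N)) (w : Fin N → ℝ) {e : Fin N} (he : M.Indep {e}) :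
    w e ≤ optWeight M w := by
  have := le_ciSup (f := fun S : {S : Finset (Fin N) // M.Indep (S : Set (Fin N))} =>
    ∑ e ∈ S.1, w e) (Set.finite_range _).bddAbove ⟨{e}, by simpa using he⟩
  rw [sum_singleton] at this
  exact this

lemma le_optWeight_parallelMatroid (w : Fin N → ℝ) {e : Fin N} (he : e.val < n) :
    w e ≤ optWeight (parallelMatroid N n) w :=
  le_optWeight _ w (parallelMatroid_indep.2 ⟨Set.subsingleton_singleton, by simpa using he⟩)

end ParallelMatroid

/-! ### Acceptance probabilities on parallel elements -/

namespace OnlineAlgorithm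

variable {N n : ℕ} (A : OnlineAlgorithm.{u})

/-- The probability that the algorithm accepts the element number `t` when all elements seen so
far are parallel. -/
noncomputable def acceptProb (t : ℕ) (x : Fin (t + 1) → ℝ) : ℝ :=
  A.prob.real {s | A.accept s t x {S | #S ≤ 1} = true}

lemma measurableSet_accept (t : ℕ) (x : Fin (t + 1) → ℝ) (F : Set (Finset (Fin (t + 1)))) :
    MeasurableSet {s | A.accept s t x F = true} :=
  A.measurable_accept t x F (measurableSet_singleton true)

lemma acceptProb_nonneg (t : ℕ) (x : Fin (t + 1) → ℝ) : 0 ≤ A.acceptProb t x :=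
  MeasureTheory.measureReal_nonneg

/-- Observations do not depend on the seed, so linearity of expectation separates the positions. -/
lemma expectedWeight_eq_sum (M : Matroid (Fin N)) (π : Equiv.Perm (Fin N)) (w : Fin N → ℝ) :
    A.expectedWeight M π w = ∑ i : Fin N,
      A.prob.real {s | A.accept s i (observedWeights π w i) (observedIndep M π i) = true}
        * w (π i) := by
  have h (s : A.Seed) : ∑ e ∈ A.selected M π w s, w e = ∑ i : Fin N,
      {s | A.accept s i (observedWeights π w i) (observedIndep M π i) = true}.indicator
        (fun _ => w (π i)) s := by
    simp [selected, sum_filter, Set.indicator_apply]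
  simp_rw [expectedWeight, h]
  rw [MeasureTheory.integral_finsetSum]
  · refine sum_congr rfl fun i _ => ?_
    rw [MeasureTheory.integral_indicator_const _ (A.measurableSet_accept _ _ _), smul_eq_mul]
  · intro i _
    exact (MeasureTheory.integrable_const _).indicator (A.measurableSet_accept _ _ _)

lemma mem_selected_one {M : Matroid (Fin N)} {v : Fin N → ℝ} {s : A.Seed} {t : Fin N} :
    t ∈ A.selected M 1 v s ↔
      A.accept s t (observedWeights 1 v t) (observedIndep M 1 t) = true := by
  simp [selected]
  rfl

/-- An algorithm that never selects a loop collects weight only from the first `n` elements. -/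
lemma expectedWeight_parallelMatroid (v : Fin N → ℝ)
    (h : ∀ s, (parallelMatroid N n).Indep (A.selected (parallelMatroid N n) 1 v s)) :
    A.expectedWeight (parallelMatroid N n) 1 v
      = ∑ t : Fin N with t.val < n, A.acceptProb t (observedWeights 1 v t) * v t := by
  rw [expectedWeight_eq_sum, sum_filter]
  refine sum_congr rfl fun t _ => ?_
  split_ifs with ht
  · rw [observedIndep_parallelMatroid (arrived_one_lt ht)]
    rfl
  · have : {s | A.accept s t (observedWeights 1 v t)
        (observedIndep (parallelMatroid N n) 1 t) = true} = ∅ := by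
      ext s
      refine iff_of_false (fun hs => ht ?_) (Set.notMem_empty s)
      exact (h s).2 t (A.mem_selected_one.2 hs)
    rw [this]
    simp

/-- At most one of several parallel elements is selected. -/
lemma sum_acceptProb_le_one (v : Fin N → ℝ)
    (h : ∀ s, (parallelMatroid N n).Indep (A.selected (parallelMatroid N n) 1 v s)) :
    ∑ t : Fin N with t.val < n, A.acceptProb t (observedWeights 1 v t) ≤ 1 := by
  unfold acceptProb
  rw [← MeasureTheory.measureReal_biUnion_finset]
  · exact MeasureTheory.measureReal_le_one
  · intro t ht t' ht' hne
    refine Set.disjoint_left.2 fun s hs hs' => hne ?_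
    have ht1 : t.val < n := by simpa using ht
    have ht1' : t'.val < n := by simpa using ht'
    refine (h s).1 (A.mem_selected_one.2 ?_) (A.mem_selected_one.2 ?_)
    · rw [observedIndep_parallelMatroid (arrived_one_lt ht1)]; exact hs
    · rw [observedIndep_parallelMatroid (arrived_one_lt ht1')]; exact hs'
  · exact fun t _ => A.measurableSet_accept _ _ _

/-- The expected weight collected from parallel elements that arrive in the order `π`. -/
lemma expectedWeight_parallelMatroid_self (π : Equiv.Perm (Fin n)) (v : Fin n → ℝ) :
    A.expectedWeight (parallelMatroid n n) π v
      = ∑ t : Fin n, A.acceptProb t (observedWeights π v t) * v (π t) := by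
  rw [expectedWeight_eq_sum]
  refine sum_congr rfl fun t _ => ?_
  rw [observedIndep_parallelMatroid fun j => Fin.is_lt _]
  rfl

end OnlineAlgorithm

/-! ### From the secretary models to selection rules -/

section Reductions

variable {M N K : ℕ} {α : ℝ}

lemma sum_le_of_permExpect_le {n : ℕ} {f g : Equiv.Perm (Fin n) → ℝ}
    (h : permExpect f ≤ α * permExpect g) : ∑ σ, f σ ≤ α * ∑ σ, g σ := by
  unfold permExpect at h
  rw [← mul_div_assoc] at h
  exact (div_le_div_iff_of_pos_right (by positivity)).1 h

/-- The lower bound for adversarial order and random assignment, in terms of the scale `M`. -/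
theorem ApproximatesAORA.le_of_pow_le {A : OnlineAlgorithm.{u}} (hA : ApproximatesAORA A N α)
    (hM : 2 ≤ M) (hK : (M ^ 2) ^ K ≤ N) (hKM : K ≤ M) : K ≤ 48 * α := by
  have hA' (n : ℕ) := hA (parallelMatroid N n) 1 (hardWeight M N) parallelMatroid_ground
    hardWeight_injective hardWeight_nonneg
  refine le_of_competitive_hardWeight hM hK hKM
    (fun σ t => A.acceptProb t (observedWeights σ (hardWeight M N) t))
    (fun σ t => A.acceptProb_nonneg _ _)
    -- The mass bound comes from the largest instance, `n = (M ^ 2) ^ K`; the smaller instances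
    -- share its acceptance probabilities.
    (fun σ => A.sum_acceptProb_le_one (hardWeight M N ∘ σ) ((hA' _).1 σ)) α fun i _ =>
      ⟨fun σ => optWeight (parallelMatroid N ((M ^ 2) ^ i)) (hardWeight M N ∘ σ),
        fun σ t ht => le_optWeight_parallelMatroid (hardWeight M N ∘ σ) ht, ?_⟩
  refine (sum_le_of_permExpect_le (hA' ((M ^ 2) ^ i)).2).trans_eq ?_
  congr 1
  exact sum_congr rfl fun σ _ =>
    A.expectedWeight_parallelMatroid (hardWeight M N ∘ σ) ((hA' _).1 σ)

lemma sum_filter_val_lt {n : ℕ} (h : n ≤ N) (f : Fin N → ℝ) :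
    ∑ t : Fin N with t.val < n, f t = ∑ t : Fin n, f (Fin.castLE h t) := by
  symm
  refine sum_bij (fun t _ => Fin.castLE h t) (fun t _ => by simp)
    (fun a _ b _ hab => Fin.castLE_injective h hab) (fun t ht => ?_) fun _ _ => rfl
  exact ⟨⟨t, by simpa using ht⟩, mem_univ _, rfl⟩

/-- Averaging over the random order of a prefix of a uniformly random sequence has no effect. -/
lemma sum_perm_sum_perm_prefix {n : ℕ} (h : n ≤ N) (F : (Fin n → Fin N) → ℝ) :
    ∑ σ : Equiv.Perm (Fin N), permExpect (fun π : Equiv.Perm (Fin n) =>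
        F fun j => σ (Fin.castLE h (π j)))
      = ∑ σ : Equiv.Perm (Fin N), F fun j => σ (Fin.castLE h j) := by
  unfold permExpect
  rw [← sum_div, sum_comm, div_eq_iff (by positivity)]
  have (π : Equiv.Perm (Fin n)) :
      ∑ σ : Equiv.Perm (Fin N), F (fun j => σ (Fin.castLE h (π j)))
        = ∑ σ : Equiv.Perm (Fin N), F fun j => σ (Fin.castLE h j) := by
    -- Extend `π` by the identity beyond the prefix and absorb it into `σ`.
    rw [← Equiv.sum_comp (Equiv.mulRight (π.viaEmbedding (Fin.castLEEmb h)))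
      fun σ : Equiv.Perm (Fin N) => F fun j => σ (Fin.castLE h j)]
    refine sum_congr rfl fun σ _ => congrArg F (funext fun j => ?_)
    exact congrArg σ (π.viaEmbedding_apply (Fin.castLEEmb h) j).symm
  rw [sum_congr rfl fun π _ => this π]
  simp [Fintype.card_perm, mul_comm]

/-- The lower bound for random order and adversarial assignment, when the number of elements is
unknown, in terms of the scale `M`. -/
theorem le_of_approximatesROAA {A : OnlineAlgorithm.{u}}
    (hA : ∀ n, 1 ≤ n → n ≤ N → ApproximatesROAA A n α)
    (hM : 2 ≤ M) (hK : (M ^ 2) ^ K ≤ N) (hKM : K ≤ M) : K ≤ 48 * α := by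
  have hL1 : 1 ≤ M ^ 2 := Nat.one_le_pow _ _ (by omega)
  have hle {i : ℕ} (hi : i ≤ K) : (M ^ 2) ^ i ≤ N := (Nat.pow_le_pow_right hL1 hi).trans hK
  have hA' {n : ℕ} (h1 : 1 ≤ n) (hn : n ≤ N) (σ : Equiv.Perm (Fin N)) :=
    hA n h1 hn (parallelMatroid n n) (fun j => hardWeight M N (σ (Fin.castLE hn j)))
      parallelMatroid_ground fun _ => hardWeight_nonneg _
  refine le_of_competitive_hardWeight hM hK hKM
    (fun σ t => A.acceptProb t (observedWeights σ (hardWeight M N) t))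
    (fun σ t => A.acceptProb_nonneg _ _) (fun σ => ?_) α fun i hi => ?_
  -- Independence holds for every arrival order, so the identity order may be chosen here.
  · have h := A.sum_acceptProb_le_one _ ((hA' (Nat.one_le_pow _ _ hL1) hK σ).1 1)
    rw [sum_filter_val_lt le_rfl] at h
    rw [sum_filter_val_lt hK]
    exact h
  · have hn := hle hi
    refine ⟨fun σ => optWeight (parallelMatroid ((M ^ 2) ^ i) ((M ^ 2) ^ i))
      fun j => hardWeight M N (σ (Fin.castLE hn j)), fun σ t ht => ?_, ?_⟩
    · exact le_optWeight_parallelMatroid (e := ⟨t, ht⟩)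
        (fun j => hardWeight M N (σ (Fin.castLE hn j))) ht
    · refine (sum_le_sum fun σ _ => (hA' (Nat.one_le_pow _ _ hL1) hn σ).2).trans_eq ?_
      rw [← mul_sum]
      congr 1
      simp_rw [A.expectedWeight_parallelMatroid_self, sum_filter_val_lt hn]
      -- The collected weight depends on `π` and `σ` only through the sequence of arriving weights,
      -- so the inner average over `π` disappears.
      exact sum_perm_sum_perm_prefix hn fun x => ∑ t : Fin ((M ^ 2) ^ i),
        A.acceptProb t (fun j => hardWeight M N
          (x (Fin.castLE (Nat.succ_le_of_lt t.isLt) j))) * hardWeight M N (x t)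

end Reductions

/-! ### Choice of the scale and conclusion -/

/-- A suitable scale for `N` elements. -/
lemma exists_scale : ∃ N₀ : ℕ, ∀ N : ℕ, N₀ ≤ N → ∃ M K : ℕ, 2 ≤ M ∧ (M ^ 2) ^ K ≤ N ∧ K ≤ M ∧
    Real.log N / Real.log (Real.log N) ≤ 8 * K := by
  have hlim : Filter.Tendsto (fun N : ℕ => Real.log N) Filter.atTop Filter.atTop :=
    Real.tendsto_log_atTop.comp tendsto_natCast_atTop_atTop
  -- The constant 8 lets `x ≤ 4 * (K + 1) * log x` absorb its `4 * log x` into `x / 2`, leaving `x ≤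
  -- 8 * K * log x`.
  have hsmall : ∀ᶠ x : ℝ in Filter.atTop, Real.log x ≤ x / 8 := by
    filter_upwards [Real.isLittleO_log_id_atTop.bound (by norm_num : (0 : ℝ) < 1 / 8),
      Filter.eventually_ge_atTop 1] with x hx hx1
    rw [Real.norm_of_nonneg (Real.log_nonneg hx1), id, Real.norm_of_nonneg (by linarith)] at hx
    linarith
  obtain ⟨N₀, hN₀⟩ := Filter.eventually_atTop.1
    ((hlim.eventually hsmall).and (hlim.eventually (Filter.eventually_ge_atTop 3)))
  refine ⟨N₀, fun N hN => ?_⟩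
  obtain ⟨hlog, h3⟩ := hN₀ N hN
  set x := Real.log N with hx
  have hN0 : N ≠ 0 := by
    rintro rfl
    norm_num [hx] at h3
  have hNpos : (0 : ℝ) < N := by positivity
  have hxM : x ≤ ⌈x⌉₊ := Nat.le_ceil x
  have hMx : (⌈x⌉₊ : ℝ) < x + 1 := Nat.ceil_lt_add_one (by linarith)
  -- `M` is `log N` rounded up, and `K` below is the largest exponent with `(M ^ 2) ^ K ≤ N`.
  set M := ⌈x⌉₊ with hM
  have hM2 : 2 ≤ M := by
    have : (2 : ℝ) ≤ M := by linarith
    exact_mod_cast this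
  have hb : 1 < M ^ 2 := by nlinarith
  have hMpos : (0 : ℝ) < M := by linarith
  have hllpos : 0 < Real.log x := Real.log_pos (by linarith)
  -- This gives `K ≤ K * (2 * log M) ≤ log N ≤ M`.
  have hlM1 : 1 / 2 ≤ Real.log M := by
    have := Real.log_two_gt_d9
    have h2 : Real.log 2 ≤ Real.log M := Real.log_le_log (by norm_num) (by exact_mod_cast hM2)
    linarith
  -- Uses `M < x + 1 ≤ x ^ 2`, valid since `x ≥ 3`.
  have hlM2 : Real.log M ≤ 2 * Real.log x := by
    have : Real.log M ≤ Real.log (x ^ 2) := Real.log_le_log hMpos (by nlinarith)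
    rw [Real.log_pow] at this
    exact_mod_cast this
  have hKle : (M ^ 2) ^ Nat.log (M ^ 2) N ≤ N := Nat.pow_log_le_self _ hN0
  have hKlt : N < (M ^ 2) ^ (Nat.log (M ^ 2) N + 1) := Nat.lt_pow_succ_log_self hb N
  set K := Nat.log (M ^ 2) N
  have h1 : K * (2 * Real.log M) ≤ x := by
    have : Real.log (((M : ℝ) ^ 2) ^ K) ≤ Real.log N :=
      Real.log_le_log (by positivity) (by exact_mod_cast hKle)
    rw [Real.log_pow, Real.log_pow] at this
    exact_mod_cast this
  have h2 : x ≤ (K + 1) * (2 * Real.log M) := by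
    have : Real.log N ≤ Real.log (((M : ℝ) ^ 2) ^ (K + 1)) :=
      Real.log_le_log hNpos (by exact_mod_cast hKlt.le)
    rw [Real.log_pow, Real.log_pow] at this
    exact_mod_cast this
  refine ⟨M, K, hM2, hKle, ?_, ?_⟩
  · have hK0 : (0 : ℝ) ≤ K := by positivity
    have : (K : ℝ) ≤ M := by nlinarith
    exact_mod_cast this
  · rw [div_le_iff₀ hllpos]
    have h3 : x ≤ (K + 1) * (4 * Real.log x) :=
      h2.trans (mul_le_mul_of_nonneg_left (by linarith) (by positivity))
    linarith

end MatroidSecretary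

theorem mainTheorem3 :
    ∃ c : ℝ, 0 < c ∧ ∃ N₀ : ℕ, ∀ N : ℕ, N₀ ≤ N → ∀ α : ℝ,
      (∀ A : MatroidSecretary.MNAlgorithm,
        MatroidSecretary.ApproximatesAORAMN A N α →
          c * (Real.log N / Real.log (Real.log N)) ≤ α) ∧
      (∀ A : MatroidSecretary.MUAlgorithm,
        MatroidSecretary.ApproximatesAORAMU A N α →
          c * (Real.log N / Real.log (Real.log N)) ≤ α) ∧
      (∀ A : MatroidSecretary.MUAlgorithm,
        (∀ n : ℕ, 1 ≤ n → n ≤ N → MatroidSecretary.ApproximatesROAAMU A n α) →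
          c * (Real.log N / Real.log (Real.log N)) ≤ α) := by
  obtain ⟨N₀, hN₀⟩ := MatroidSecretary.exists_scale
  -- `384 = 8 * 48`: the loss in choosing the scale times the loss in the hard-distribution bound.
  refine ⟨1 / 384, by norm_num, N₀, fun N hN α => ?_⟩
  obtain ⟨M, K, hM, hK, hKM, hlog⟩ := hN₀ N hN
  have hc (h : (K : ℝ) ≤ 48 * α) :
      1 / 384 * (Real.log N / Real.log (Real.log N)) ≤ α := by linarith
  exact ⟨fun A hA => hc (MatroidSecretary.ApproximatesAORA.le_of_pow_le hA hM hK hKM),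
    fun A hA => hc (MatroidSecretary.ApproximatesAORA.le_of_pow_le hA hM hK hKM),
    fun A hA => hc (MatroidSecretary.le_of_approximatesROAA hA hM hK hKM)⟩
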